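/- Let $\mathbb{B}$ be the open unit ball of $\mathbb{C}^{2\times 2}$ in the operator norm, let $\pi(A)=(a_{21},\operatorname{tr}A,\det A)$ for $A=[a_{ij}]\in\mathbb{C}^{2\times 2}$, and let $\mathcal{P}=\pi(\mathbb{B})\subset\mathbb{C}^3$ be the pentablock, with closure $\bar{\mathcal{P}}$. Let $\mathbb{G}=\{(z+w,zw): |z|<1,\ |w|<1\}\subset\mathbb{C}^2$ be the open symmetrised bidisc, with closure $\Gamma$. For a domain $\Omega\subset\mathbb{C}^n$ let $A(\Omega)$ be the algebra of continuous complex-valued functions on $\bar\Omega$ that are holomorphic on $\Omega$. A boundary for $\Omega$ is a set $C\subset\bar\Omega$ such that every $f\in A(\Omega)$ attains its maximum modulus over $\bar\Omega$ at a point of $C$; the distinguished (Shilov) boundary of $\Omega$ is the smallest closed boundary for $\Omega$ (the one contained in all the closed boundaries for $\Omega$), when it exists. A peak point of $\bar\Omega$ is a point $u\in\bar\Omega$ for which there is $g\in A(\Omega)$ with $g(u)=1$ and $|g(x)|<1$ for all $x\in\bar\Omega\setminus\{u\}$. **Theorem.** The distinguished boundary $b\Gamma$ of $\mathbb{G}$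 exists and is the symmetrised torus, $b\Gamma=\{(z_1+z_2,z_1z_2): |z_1|=|z_2|=1\}$. The distinguished boundary $b\mathcal{P}$ of $\mathcal{P}$ also exists. With $$K_0=\Big\{(a,s,p)\in\mathbb{C}^3: (s,p)\in b\Gamma,\ |a|=\sqrt{1-\tfrac14|s|^2}\Big\},$$ the following are equivalent for $x\in\mathbb{C}^3$: 1. $x\in K_0$; 2. $x$ is a peak point of $\bar{\mathcal{P}}$; 3. $x\in b\mathcal{P}$. Therefore $$b\mathcal{P}=\Big\{(a,s,p)\in\mathbb{C}^3: (s,p)\in b\Gamma,\ |a|=\sqrt{1-\tfrac14|s|^2}\Big\},$$ and so $$b\mathcal{P}=\Big\{(a,s,p)\in\mathbb{C}^3: |s|\le 2,\ |p|=1,\ s=\bar s p,\ |a|=\sqrt{1-\tfrac14|s|^2}\Big\}.$$ -/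

import Mathlib

open Matrix

section

/-- The open unit ball `𝔹` of the space of `2 × 2` complex matrices, with respect to the operator
norm induced by the Euclidean norm of `ℂ²`. -/
def matrixBall : Set (Matrix (Fin 2) (Fin 2) ℂ) :=
  {A | ‖Matrix.toEuclideanCLM (n := Fin 2) (𝕜 := ℂ) A‖ < 1}

/-- The polynomial map `π(A) = (a₂₁, tr A, det A)`. -/
def pentaMap (A : Matrix (Fin 2) (Fin 2) ℂ) : ℂ × ℂ × ℂ :=
  (A 1 0, A.trace, A.det)

/-- The pentablock `𝒫 = π(𝔹)`. -/
def pentablock : Set (ℂ × ℂ × ℂ) :=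
  pentaMap '' matrixBall

/-- The open symmetrised bidisc `𝔾 = {(z + w, zw) : |z| < 1, |w| < 1}`; its closure is `Γ`. -/
def symBidisc : Set (ℂ × ℂ) :=
  {x | ∃ z w : ℂ, ‖z‖ < 1 ∧ ‖w‖ < 1 ∧ x = (z + w, z * w)}

/-- The symmetrised torus `{(z₁ + z₂, z₁z₂) : |z₁| = |z₂| = 1}`. -/
def symTorus : Set (ℂ × ℂ) :=
  {x | ∃ z w : ℂ, ‖z‖ = 1 ∧ ‖w‖ = 1 ∧ x = (z + w, z * w)}

end

section

variable {E : Type*} [NormedAddCommGroup E] [NormedSpace ℂ E]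

/-- The algebra `A(Ω)` of functions continuous on the closure of `Ω` and holomorphic on `Ω`.
Elements are represented by total functions, whose values off the closure of `Ω` are irrelevant. -/
def discAlgebra (Ω : Set E) : Set (E → ℂ) :=
  {f | ContinuousOn f (closure Ω) ∧ DifferentiableOn ℂ f Ω}

/-- `C` is a boundary for `Ω`: it is contained in the closure of `Ω`, and every function in `A(Ω)`
attains its maximum modulus over the closure of `Ω` at a point of `C`. -/
def IsBoundaryFor (Ω C : Set E) : Prop :=
  C ⊆ closure Ω ∧ ∀ f ∈ discAlgebra Ω, ∃ c ∈ C, ∀ x ∈ closure Ω, ‖f x‖ ≤ ‖f c‖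

/-- The collection of all closed boundaries for `Ω`. -/
def closedBoundaries (Ω : Set E) : Set (Set E) :=
  {C | IsClosed C ∧ IsBoundaryFor Ω C}

/-- The intersection of all closed boundaries for `Ω`. If a smallest closed boundary exists, this
is the smallest closed boundary, i.e. the distinguished (Shilov) boundary `bΩ`. -/
def distinguishedBoundary (Ω : Set E) : Set E :=
  ⋂₀ closedBoundaries Ω

/-- `u` is a peak point of the closure of `Ω`, with respect to the algebra `A(Ω)`. -/
def IsPeakPoint (Ω : Set E) (u : E) : Prop :=
  u ∈ closure Ω ∧ ∃ g ∈ discAlgebra Ω, g u = 1 ∧ ∀ x ∈ closure Ω \ {u}, ‖g x‖ < 1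

end

/-- `K₀ = {(a, s, p) : (s, p) ∈ bΓ, |a| = √(1 - |s|²/4)}`, where `bΓ` is the distinguished boundary
of the symmetrised bidisc. -/
def pentaK₀ : Set (ℂ × ℂ × ℂ) :=
  {x | (x.2.1, x.2.2) ∈ distinguishedBoundary symBidisc ∧
    ‖x.1‖ = Real.sqrt (1 - (1 / 4) * ‖x.2.1‖ ^ 2)}

/-!
A point of `closure Ω` is a peak point as soon as some function in the algebra has a real part with
a strict maximum there: exponentiate. Such functions come from strict convexity of Hilbert space
norms. On the closure of `𝒫` one has `‖a‖² + ‖s / 2‖² ≤ 1` and `‖p‖ ≤ 1`, with equality in both on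
`K₀`, so the points of `K₀` have maximal Euclidean norm in the coordinates `(a, s / 2, p)` and are
peaked by linear functionals. Points of the symmetrised torus are peaked in the same way, using
`‖s / 2‖² + ‖p - (s / 2)²‖ ≤ 1`.

Every boundary contains all peak points, so it remains to see that these sets are boundaries. The
maximum principle in each variable makes the torus a boundary for the polydisc, and a boundary is
carried by a holomorphic map to a boundary for the image. Symmetrisation gives `bΓ`. The singular
value decomposition embeds a polydisc in the matrix ball through each given matrix, its torus
consisting of unitary matrices, so `π(U(2))` is a boundary for `𝒫`. That set is the union of the
discs `‖a‖² ≤ 1 - ‖s / 2‖²` over `(s, p) ∈ bΓ`, and the maximum principle on each of them moves the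
maximum of `|f|` to its edge, which lies in `K₀`.
-/

open Set Metric Filter Topology Function
open scoped ComplexConjugate Matrix.Norms.L2Operator

section Boundary

variable {E E' : Type*} [NormedAddCommGroup E] [NormedSpace ℂ E]
  [NormedAddCommGroup E'] [NormedSpace ℂ E'] {Ω C K : Set E} {Ω' C' : Set E'} {u : E} {f : E → ℂ}

lemma mem_discAlgebra_of_differentiable (hf : Differentiable ℂ f) : f ∈ discAlgebra Ω :=
  ⟨hf.continuous.continuousOn, hf.differentiableOn⟩

lemma comp_mem_discAlgebra (hf : f ∈ discAlgebra Ω) {φ : E' → E} (hφ : Differentiable ℂ φ)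
    (hmaps : MapsTo φ Ω' Ω) : f ∘ φ ∈ discAlgebra Ω' :=
  ⟨hf.1.comp hφ.continuous.continuousOn (hmaps.closure hφ.continuous),
    hf.2.comp hφ.differentiableOn hmaps⟩

lemma norm_le_on_closure_of_mem_discAlgebra (hf : f ∈ discAlgebra Ω) {M : ℝ}
    (hM : ∀ x ∈ Ω, ‖f x‖ ≤ M) : ∀ x ∈ closure Ω, ‖f x‖ ≤ M := fun _ hx =>
  isClosed_Iic.closure_subset (((hf.1.norm _ hx).mono subset_closure).mem_closure hx hM)

lemma isBoundaryFor_closure (hcompact : IsCompact (closure Ω)) (hne : Ω.Nonempty) :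
    IsBoundaryFor Ω (closure Ω) :=
  ⟨Subset.rfl, fun _ hf => hcompact.exists_isMaxOn hne.closure hf.1.norm⟩

lemma IsBoundaryFor.of_forall_exists_norm_le (hC : IsBoundaryFor Ω C) (hK : K ⊆ closure Ω)
    (h : ∀ f ∈ discAlgebra Ω, ∀ c ∈ C, ∃ k ∈ K, ‖f c‖ ≤ ‖f k‖) : IsBoundaryFor Ω K := by
  refine ⟨hK, fun f hf => ?_⟩
  obtain ⟨c, hc, hmax⟩ := hC.2 f hf
  obtain ⟨k, hk, hck⟩ := h f hf c hc
  exact ⟨k, hk, fun x hx => (hmax x hx).trans hck⟩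

lemma IsBoundaryFor.image (hC : IsBoundaryFor Ω' C') {φ : E' → E} (hφ : Differentiable ℂ φ) :
    IsBoundaryFor (φ '' Ω') (φ '' C') := by
  have hmaps := mapsTo_image φ Ω'
  refine ⟨(hmaps.closure hφ.continuous).image_subset.trans' (image_mono hC.1), fun f hf => ?_⟩
  obtain ⟨c, hc, hmax⟩ := hC.2 _ (comp_mem_discAlgebra hf hφ hmaps)
  refine ⟨φ c, mem_image_of_mem φ hc, norm_le_on_closure_of_mem_discAlgebra hf ?_⟩
  rintro _ ⟨x, hx, rfl⟩
  exact hmax x (subset_closure hx)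

lemma IsPeakPoint.mem_of_isBoundaryFor (hu : IsPeakPoint Ω u) (hC : IsBoundaryFor Ω C) :
    u ∈ C := by
  obtain ⟨hu, g, hg, hgu, hlt⟩ := hu
  obtain ⟨c, hc, hmax⟩ := hC.2 g hg
  suffices c = u from this ▸ hc
  by_contra hne
  have hge : 1 ≤ ‖g c‖ := by simpa [hgu] using hmax u hu
  exact (hlt c ⟨hC.1 hc, hne⟩).not_ge hge

lemma IsPeakPoint.mem_distinguishedBoundary (hu : IsPeakPoint Ω u) :
    u ∈ distinguishedBoundary Ω :=
  mem_sInter.2 fun _ hC => hu.mem_of_isBoundaryFor hC.2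

lemma distinguishedBoundary_eq_of_forall_isPeakPoint (hK : K ∈ closedBoundaries Ω)
    (hpeak : ∀ u ∈ K, IsPeakPoint Ω u) : distinguishedBoundary Ω = K :=
  (sInter_subset_of_mem hK).antisymm fun u hu => (hpeak u hu).mem_distinguishedBoundary

lemma isLeast_distinguishedBoundary (h : distinguishedBoundary Ω ∈ closedBoundaries Ω) :
    IsLeast (closedBoundaries Ω) (distinguishedBoundary Ω) :=
  ⟨h, fun _ hC => sInter_subset_of_mem hC⟩

end Boundary

section PeakPoint

variable {E : Type*} [NormedAddCommGroup E] [NormedSpace ℂ E] {Ω : Set E} {u : E}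

lemma isPeakPoint_of_forall_re_lt {h : E → ℂ} (hh : h ∈ discAlgebra Ω) (hu : u ∈ closure Ω)
    (hlt : ∀ x ∈ closure Ω, x ≠ u → (h x).re < (h u).re) : IsPeakPoint Ω u := by
  refine ⟨hu, fun x => Complex.exp (h x - h u), ⟨?_, ?_⟩, by simp, fun x hx => ?_⟩
  · exact Complex.continuous_exp.comp_continuousOn (hh.1.sub continuousOn_const)
  · exact Complex.differentiable_exp.comp_differentiableOn (hh.2.sub_const _)
  · simpa [Complex.norm_exp] using hlt x hx.1 hx.2

lemma re_inner_lt_norm_sq {𝕜 F : Type*} [RCLike 𝕜] [NormedAddCommGroup F] [InnerProductSpace 𝕜 F]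
    {v w : F} (hle : ‖w‖ ≤ ‖v‖) (hne : w ≠ v) : RCLike.re (inner 𝕜 v w) < ‖v‖ ^ 2 := by
  have hpos : 0 < ‖v - w‖ ^ 2 := by
    have := norm_sub_pos_iff.2 hne.symm
    positivity
  have hsq : ‖w‖ ^ 2 ≤ ‖v‖ ^ 2 := by gcongr
  rw [norm_sub_sq (𝕜 := 𝕜)] at hpos
  linarith

lemma isPeakPoint_of_forall_norm_le {F : Type*} [NormedAddCommGroup F] [InnerProductSpace ℂ F]
    {φ : E → F} (hφ : Differentiable ℂ φ) (hinj : Injective φ) (hu : u ∈ closure Ω)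
    (hmax : ∀ x ∈ closure Ω, ‖φ x‖ ≤ ‖φ u‖) : IsPeakPoint Ω u := by
  have hdiff : Differentiable ℂ fun x => inner ℂ (φ u) (φ x) :=
    (innerSL ℂ (φ u)).differentiable.comp hφ
  refine isPeakPoint_of_forall_re_lt (mem_discAlgebra_of_differentiable hdiff) hu fun x hx hne => ?_
  calc (inner ℂ (φ u) (φ x)).re < ‖φ u‖ ^ 2 :=
        re_inner_lt_norm_sq (𝕜 := ℂ) (hmax x hx) (hinj.ne hne)
    _ = (inner ℂ (φ u) (φ u)).re := (inner_self_eq_norm_sq (𝕜 := ℂ) (φ u)).symm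

end PeakPoint

section AnalyticDiscs

lemma differentiableOn_of_continuousOn_uncurry {X F : Type*} [TopologicalSpace X]
    [NormedAddCommGroup F] [NormedSpace ℂ F] [CompleteSpace F] {S : Set X} {x₀ : X}
    [(𝓝[S] x₀).NeBot] {U : Set ℂ} (hU : IsOpen U) {G : X → ℂ → F}
    (hcont : ContinuousOn (uncurry G) (insert x₀ S ×ˢ U))
    (hdiff : ∀ x ∈ S, DifferentiableOn ℂ (G x) U) : DifferentiableOn ℂ (G x₀) U := by
  have hunif : TendstoLocallyUniformlyOn G (G x₀) (𝓝[S] x₀) U := by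
    refine tendstoLocallyUniformlyOn_iff_forall_tendsto.2 fun t ht => ?_
    have h₀ : Tendsto (G x₀) (𝓝[U] t) (𝓝 (G x₀ t)) :=
      hcont.uncurry_left x₀ (mem_insert x₀ S) t ht
    have h : Tendsto (uncurry G) (𝓝[S] x₀ ×ˢ 𝓝[U] t) (𝓝 (G x₀ t)) :=
      (hcont (x₀, t) ⟨mem_insert x₀ S, ht⟩).mono_left <| by
        rw [nhdsWithin_prod_eq]
        gcongr
        exact subset_insert x₀ S
    exact ((h₀.comp tendsto_snd).prodMk_nhds h).mono_right (nhds_le_uniformity _)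
  exact hunif.differentiableOn (eventually_mem_nhdsWithin.mono hdiff) hU

variable {E : Type*} [NormedAddCommGroup E] [NormedSpace ℂ E] {Ω : Set E} {f : E → ℂ}

/- The disc `H 1` may lie in the boundary of `Ω`, where `f` is only continuous; along it `f` is a
locally uniform limit of the holomorphic functions `f ∘ H r`. -/
lemma exists_norm_eq_one_and_norm_le (hf : f ∈ discAlgebra Ω) {H : ℝ → ℂ → E}
    (hcont : Continuous (uncurry H)) (hdiff : ∀ r, Differentiable ℂ (H r))
    (hmem : ∀ r ∈ Ico (0 : ℝ) 1, ∀ t, ‖t‖ ≤ 1 → H r t ∈ Ω) {t : ℂ} (ht : ‖t‖ ≤ 1) :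
    ∃ t', ‖t'‖ = 1 ∧ ‖f (H 1 t)‖ ≤ ‖f (H 1 t')‖ := by
  have hclosure : ∀ r ∈ Icc (0 : ℝ) 1, ∀ t ∈ closedBall (0 : ℂ) 1, H r t ∈ closure Ω := by
    intro r hr t ht
    rw [← closure_Ico zero_ne_one] at hr
    exact map_mem_closure (f := fun r => H r t) (by fun_prop) hr
      fun r hr => hmem r hr t (mem_closedBall_zero_iff.1 ht)
  have hfH : ContinuousOn (uncurry fun r t => f (H r t)) (Icc 0 1 ×ˢ closedBall 0 1) :=
    hf.1.comp hcont.continuousOn fun q hq => hclosure q.1 hq.1 q.2 hq.2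
  have : (𝓝[Ico (0 : ℝ) 1] 1).NeBot :=
    mem_closure_iff_nhdsWithin_neBot.1 (by simp [closure_Ico zero_ne_one])
  have hdisc : DiffContOnCl ℂ (fun t => f (H 1 t)) (ball 0 1) := by
    refine ⟨differentiableOn_of_continuousOn_uncurry (S := Ico (0 : ℝ) 1) (x₀ := 1)
      (G := fun r t => f (H r t)) isOpen_ball ?_ ?_, ?_⟩
    · exact hfH.mono
        (prod_mono (insert_subset (by simp) Ico_subset_Icc_self) ball_subset_closedBall)
    · exact fun r hr => hf.2.comp (hdiff r).differentiableOn
        fun t ht => hmem r hr t (mem_ball_zero_iff.1 ht).le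
    · rw [closure_ball _ one_ne_zero]
      exact hfH.uncurry_left 1 (by simp)
  obtain ⟨t', ht', hmax⟩ := Complex.exists_mem_frontier_isMaxOn_norm isBounded_ball
    (nonempty_ball.2 one_pos) hdisc
  rw [frontier_ball _ one_ne_zero] at ht'
  rw [closure_ball _ one_ne_zero] at hmax
  exact ⟨t', mem_sphere_zero_iff_norm.1 ht', hmax (mem_closedBall_zero_iff.2 ht)⟩

lemma ofReal_smul_mem_ball {v : E} (hv : ‖v‖ ≤ 1) {r : ℝ} (hr : r ∈ Ico (0 : ℝ) 1) :
    (r : ℂ) • v ∈ ball 0 1 := by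
  rw [mem_ball_zero_iff, norm_smul, Complex.norm_of_nonneg hr.1]
  exact mul_lt_one_of_nonneg_of_lt_one_left hr.1 hr.2 hv

section Torus

variable {ι : Type*} [Fintype ι]

lemma norm_update_le_one [DecidableEq ι] {w : ι → ℂ} (hw : ‖w‖ ≤ 1) (i : ι) {t : ℂ}
    (ht : ‖t‖ ≤ 1) : ‖update w i t‖ ≤ 1 := by
  refine (pi_norm_le_iff_of_nonneg zero_le_one).2 fun j => ?_
  rcases eq_or_ne j i with rfl | hj
  · simpa using ht
  · simpa [hj] using (norm_le_pi_norm w j).trans hw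

lemma exists_norm_eq_one_and_norm_le_update [DecidableEq ι] {f : (ι → ℂ) → ℂ}
    (hf : f ∈ discAlgebra (ball 0 1)) {w : ι → ℂ} (hw : ‖w‖ ≤ 1) (i : ι) :
    ∃ t, ‖t‖ = 1 ∧ ‖f w‖ ≤ ‖f (update w i t)‖ := by
  have hcont : Continuous (uncurry fun (r : ℝ) (t : ℂ) => (r : ℂ) • update w i t) := by
    unfold uncurry
    fun_prop
  have hdiff (r : ℝ) : Differentiable ℂ fun t => (r : ℂ) • update w i t := fun t =>
    (hasFDerivAt_update w t).differentiableAt.const_smul (r : ℂ)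
  simpa using exists_norm_eq_one_and_norm_le hf hcont hdiff
    (fun r hr t ht => ofReal_smul_mem_ball (norm_update_le_one hw i ht) hr)
    ((norm_le_pi_norm w i).trans hw)

lemma isBoundaryFor_torus : IsBoundaryFor (ball (0 : ι → ℂ) 1) {z | ∀ i, ‖z i‖ = 1} := by
  classical
  have hclosure : closure (ball (0 : ι → ℂ) 1) = closedBall 0 1 := closure_ball _ one_ne_zero
  refine (isBoundaryFor_closure ?_ (nonempty_ball.2 one_pos)).of_forall_exists_norm_le ?_ ?_
  · exact hclosure ▸ isCompact_closedBall _ _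
  · intro z hz
    rw [hclosure, mem_closedBall_zero_iff]
    exact (pi_norm_le_iff_of_nonneg zero_le_one).2 fun i => (hz i).le
  intro f hf z hz
  rw [hclosure, mem_closedBall_zero_iff] at hz
  suffices ∀ s : Finset ι, ∃ w : ι → ℂ, ‖w‖ ≤ 1 ∧ (∀ i ∈ s, ‖w i‖ = 1) ∧ ‖f z‖ ≤ ‖f w‖ by
    obtain ⟨w, -, hw, hzw⟩ := this Finset.univ
    exact ⟨w, fun i => hw i (Finset.mem_univ i), hzw⟩
  intro s
  induction s using Finset.induction_on with
  | empty => exact ⟨z, hz, by simp, le_rfl⟩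
  | insert i s hi ih =>
    obtain ⟨w, hw, hws, hzw⟩ := ih
    obtain ⟨t, ht, hle⟩ := exists_norm_eq_one_and_norm_le_update hf hw i
    refine ⟨update w i t, norm_update_le_one hw i ht.le, fun j hj => ?_, hzw.trans hle⟩
    rcases eq_or_ne j i with rfl | hji
    · simpa using ht
    · simpa [hji] using hws j (Finset.mem_of_mem_insert_of_ne hj hji)

end Torus

end AnalyticDiscs

section Matrices

variable {𝕜 n : Type*} [RCLike 𝕜] [Fintype n]

lemma exists_orthonormalBasis_eq_norm_smul {E : Type*} [NormedAddCommGroup E]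
    [InnerProductSpace 𝕜 E] [FiniteDimensional 𝕜 E]
    (hcard : Module.finrank 𝕜 E = Fintype.card n) {v : n → E}
    (hv : Pairwise fun i j => inner 𝕜 (v i) (v j) = 0) :
    ∃ b : OrthonormalBasis n 𝕜 E, ∀ i, v i = (‖v i‖ : 𝕜) • b i := by
  have horth : Orthonormal 𝕜 ({i | v i ≠ 0}.domRestrict fun i => (‖v i‖⁻¹ : 𝕜) • v i) := by
    refine ⟨fun i => norm_smul_inv_norm i.2, fun i j hij => ?_⟩
    simp [domRestrict_apply, inner_smul_left, inner_smul_right, hv (Subtype.coe_ne_coe.2 hij)]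
  obtain ⟨b, hb⟩ := horth.exists_orthonormalBasis_extension_of_card_eq hcard
  refine ⟨b, fun i => ?_⟩
  by_cases hi : v i = 0
  · simp [hi]
  · rw [hb i hi, smul_inv_smul₀ (by simpa using hi)]

variable [DecidableEq n] {A U V : Matrix n n 𝕜} {d : n → 𝕜}

lemma exists_mem_unitaryGroup_eq_mul_diagonal (hA : (Aᴴ * A).IsDiag) :
    ∃ U ∈ unitaryGroup n 𝕜, ∃ d : n → 𝕜, A = U * diagonal d := by
  have horth : Pairwise fun i j =>
      inner 𝕜 (WithLp.toLp 2 (A.col i)) (WithLp.toLp 2 (A.col j)) = 0 := fun i j hij => by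
    simpa [EuclideanSpace.inner_toLp_toLp, mul_apply, dotProduct, mul_comm] using hA hij
  obtain ⟨b, hb⟩ := exists_orthonormalBasis_eq_norm_smul (E := EuclideanSpace 𝕜 n)
    finrank_euclideanSpace horth
  refine ⟨_, (EuclideanSpace.basisFun n 𝕜).toMatrix_orthonormalBasis_mem_unitary b,
    fun i => (‖WithLp.toLp 2 (A.col i)‖ : 𝕜), ?_⟩
  ext i j
  simpa [Module.Basis.toMatrix_apply, RCLike.real_smul_eq_coe_mul, mul_comm] using
    congr_arg (· i) (hb j)

lemma exists_singular_value_decomposition (A : Matrix n n 𝕜) :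
    ∃ U ∈ unitaryGroup n 𝕜, ∃ V ∈ unitaryGroup n 𝕜, ∃ d : n → 𝕜, A = U * diagonal d * V := by
  have hH : (Aᴴ * A).IsHermitian := isHermitian_conjTranspose_mul_self A
  obtain ⟨W, hW, hdiag⟩ : ∃ W ∈ unitaryGroup n 𝕜, (star W * (Aᴴ * A) * W).IsDiag := by
    refine ⟨hH.eigenvectorUnitary, hH.eigenvectorUnitary.2, ?_⟩
    rw [← Unitary.conjStarAlgAut_star_apply (S := 𝕜), hH.conjStarAlgAut_star_eigenvectorUnitary]
    exact isDiag_diagonal _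
  rw [star_eq_conjTranspose, ← mul_assoc, ← conjTranspose_mul, mul_assoc] at hdiag
  obtain ⟨U, hU, d, hd⟩ := exists_mem_unitaryGroup_eq_mul_diagonal hdiag
  refine ⟨U, hU, star W, Unitary.star_mem hW, d, ?_⟩
  rw [← hd, mul_assoc, mem_unitaryGroup_iff.1 hW, mul_one]

lemma l2_opNorm_mul_diagonal_mul (hU : U ∈ unitaryGroup n 𝕜) (hV : V ∈ unitaryGroup n 𝕜) :
    ‖U * diagonal d * V‖ = ‖d‖ := by
  rw [CStarRing.norm_mul_mem_unitary _ hV, CStarRing.norm_mem_unitary_mul _ hU, l2_opNorm_diagonal]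

lemma norm_det_eq_one_of_mem_unitaryGroup (hU : U ∈ unitaryGroup n 𝕜) : ‖U.det‖ = 1 :=
  CStarRing.norm_of_mem_unitary (det_of_mem_unitary hU)

lemma norm_det_le_one_of_l2_opNorm_le_one (hA : ‖A‖ ≤ 1) : ‖A.det‖ ≤ 1 := by
  obtain ⟨U, hU, V, hV, d, rfl⟩ := exists_singular_value_decomposition A
  rw [l2_opNorm_mul_diagonal_mul hU hV] at hA
  rw [det_mul, det_mul, norm_mul, norm_mul, norm_det_eq_one_of_mem_unitaryGroup hU,
    norm_det_eq_one_of_mem_unitaryGroup hV, one_mul, mul_one, det_diagonal, norm_prod]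
  exact Finset.prod_le_one (fun _ _ => norm_nonneg _) fun i _ => (norm_le_pi_norm d i).trans hA

lemma l2_opNorm_le_one_of_mem_unitaryGroup (hU : U ∈ unitaryGroup n 𝕜) : ‖U‖ ≤ 1 := by
  nontriviality Matrix n n 𝕜
  exact (CStarRing.norm_of_mem_unitary hU).le

lemma sum_norm_sq_col_le (A : Matrix n n 𝕜) (j : n) : ∑ i, ‖A i j‖ ^ 2 ≤ ‖A‖ ^ 2 := by
  have h := A.l2_opNorm_mulVec (PiLp.single 2 j 1)
  rw [PiLp.norm_single, norm_one, mul_one] at h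
  have h2 := pow_le_pow_left₀ (norm_nonneg _) h 2
  rw [EuclideanSpace.norm_sq_eq] at h2
  simpa using h2

lemma sum_norm_sq_row_le (A : Matrix n n 𝕜) (i : n) : ∑ j, ‖A i j‖ ^ 2 ≤ ‖A‖ ^ 2 := by
  simpa [l2_opNorm_conjTranspose] using sum_norm_sq_col_le Aᴴ i

lemma diagonal_mem_unitaryGroup (hd : ∀ i, ‖d i‖ = 1) : diagonal d ∈ unitaryGroup n 𝕜 := by
  rw [mem_unitaryGroup_iff, star_eq_conjTranspose, diagonal_conjTranspose, diagonal_mul_diagonal,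
    ← diagonal_one]
  congr! with i
  simp [RCLike.mul_conj, hd i]

lemma mem_unitaryGroup_iff_adjugate :
    A ∈ unitaryGroup n 𝕜 ↔ ‖A.det‖ = 1 ∧ A.adjugate = A.det • Aᴴ := by
  constructor
  · intro hA
    refine ⟨norm_det_eq_one_of_mem_unitaryGroup hA, ?_⟩
    calc A.adjugate = A.adjugate * (A * Aᴴ) := by
          rw [← star_eq_conjTranspose, mem_unitaryGroup_iff.1 hA, mul_one]
      _ = A.det • Aᴴ := by rw [← mul_assoc, adjugate_mul, smul_mul_assoc, one_mul]
  · rintro ⟨hdet, hadj⟩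
    have h : A.det • (A * star A) = A.det • 1 := by
      rw [star_eq_conjTranspose, ← mul_smul_comm, ← hadj, mul_adjugate]
    exact mem_unitaryGroup_iff.2 (smul_right_injective _ (norm_ne_zero_iff.1 (by simp [hdet])) h)

lemma isBoundaryFor_unitaryGroup :
    IsBoundaryFor (ball (0 : Matrix n n ℂ) 1) (unitaryGroup n ℂ : Set (Matrix n n ℂ)) := by
  have hclosure : closure (ball (0 : Matrix n n ℂ) 1) = closedBall 0 1 :=
    closure_ball _ one_ne_zero
  refine (isBoundaryFor_closure ?_ (nonempty_ball.2 one_pos)).of_forall_exists_norm_le ?_ ?_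
  · exact hclosure ▸ isCompact_closedBall _ _
  · intro U hU
    rw [hclosure, mem_closedBall_zero_iff]
    exact l2_opNorm_le_one_of_mem_unitaryGroup hU
  intro f hf A hA
  obtain ⟨U, hU, V, hV, d, rfl⟩ := exists_singular_value_decomposition A
  rw [hclosure, mem_closedBall_zero_iff, l2_opNorm_mul_diagonal_mul hU hV] at hA
  have hdiff : Differentiable ℂ fun d : n → ℂ => U * diagonal d * V :=
    ((diagonalLinearMap n ℂ ℂ).toContinuousLinearMap.differentiable.const_mul U).mul_const V
  have hmaps : MapsTo (fun d : n → ℂ => U * diagonal d * V) (ball 0 1) (ball 0 1) := fun d hd => by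
    simpa [l2_opNorm_mul_diagonal_mul hU hV] using hd
  obtain ⟨e, he, hmax⟩ := isBoundaryFor_torus.2 _ (comp_mem_discAlgebra hf hdiff hmaps)
  refine ⟨_, mul_mem (mul_mem hU (diagonal_mem_unitaryGroup he)) hV, hmax d ?_⟩
  rwa [closure_ball _ one_ne_zero, mem_closedBall_zero_iff]

end Matrices

section SymmetrisedBidisc

/-- The symmetrisation map `(z, w) ↦ (z + w, zw)`, on `Fin 2 → ℂ` so that its sup norm balls are
bidiscs. -/
def symmetrization (z : Fin 2 → ℂ) : ℂ × ℂ := (z 0 + z 1, z 0 * z 1)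

lemma differentiable_symmetrization : Differentiable ℂ symmetrization := by
  unfold symmetrization
  fun_prop

lemma symmetrization_image_ball : symmetrization '' ball 0 1 = symBidisc := by
  ext x
  constructor
  · rintro ⟨z, hz, rfl⟩
    rw [mem_ball_zero_iff, pi_norm_lt_iff one_pos] at hz
    exact ⟨z 0, z 1, hz 0, hz 1, rfl⟩
  · rintro ⟨z, w, hz, hw, rfl⟩
    refine ⟨![z, w], ?_, rfl⟩
    rw [mem_ball_zero_iff, pi_norm_lt_iff one_pos]
    exact Fin.forall_fin_two.2 ⟨hz, hw⟩

lemma symmetrization_image_torus : symmetrization '' {z | ∀ i, ‖z i‖ = 1} = symTorus := by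
  ext x
  constructor
  · rintro ⟨z, hz, rfl⟩
    exact ⟨z 0, z 1, hz 0, hz 1, rfl⟩
  · rintro ⟨z, w, hz, hw, rfl⟩
    exact ⟨![z, w], Fin.forall_fin_two.2 ⟨hz, hw⟩, rfl⟩

lemma isBoundaryFor_symTorus : IsBoundaryFor symBidisc symTorus := by
  rw [← symmetrization_image_ball, ← symmetrization_image_torus]
  exact isBoundaryFor_torus.image differentiable_symmetrization

lemma exists_eq_ofReal_mul_and_eq_sq {s p : ℂ} (hp : ‖p‖ = 1) (h : s = conj s * p) :
    ∃ (ω : ℂ) (x : ℝ), ‖ω‖ = 1 ∧ s = x * ω ∧ p = ω ^ 2 := by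
  obtain ⟨ω, rfl⟩ := IsAlgClosed.exists_pow_nat_eq p two_pos
  have hω : ‖ω‖ = 1 := (pow_eq_one_iff_of_nonneg (norm_nonneg ω) two_ne_zero).1 (by simpa using hp)
  have hconj : conj ω * ω = 1 := by simp [Complex.conj_mul', hω]
  obtain ⟨x, hx⟩ := Complex.conj_eq_iff_real.1 (show conj (conj ω * s) = conj ω * s by
    rw [map_mul, Complex.conj_conj]
    linear_combination (-conj ω) * h - conj s * ω * hconj)
  exact ⟨ω, x, hω, by linear_combination ω * hx - s * hconj, rfl⟩

lemma exists_add_conj_eq_and_mul_conj_eq {x c : ℝ} (h : (x / 2) ^ 2 ≤ c) :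
    ∃ ζ : ℂ, ζ + conj ζ = x ∧ ζ * conj ζ = c := by
  obtain ⟨y, hy⟩ : ∃ y : ℝ, y ^ 2 = c - (x / 2) ^ 2 := ⟨_, Real.sq_sqrt (sub_nonneg.2 h)⟩
  refine ⟨⟨x / 2, y⟩, ?_, ?_⟩
  · rw [Complex.add_conj, mul_div_cancel₀ x two_ne_zero]
  · rw [Complex.mul_conj, Complex.normSq_mk]
    congr 1
    linarith

lemma mem_symTorus_iff {s p : ℂ} : (s, p) ∈ symTorus ↔ ‖s‖ ≤ 2 ∧ ‖p‖ = 1 ∧ s = conj s * p := by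
  constructor
  · rintro ⟨z, w, hz, hw, h⟩
    obtain ⟨rfl, rfl⟩ := Prod.mk.inj h
    have hz' : conj z * z = 1 := by simp [Complex.conj_mul', hz]
    have hw' : conj w * w = 1 := by simp [Complex.conj_mul', hw]
    refine ⟨(norm_add_le z w).trans (by norm_num [hz, hw]), by simp [hz, hw], ?_⟩
    rw [map_add]
    linear_combination (-w) * hz' - z * hw'
  · rintro ⟨hs, hp, h⟩
    obtain ⟨ω, x, hω, rfl, rfl⟩ := exists_eq_ofReal_mul_and_eq_sq hp h
    have hx : (x / 2) ^ 2 ≤ 1 := by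
      rw [sq_le_one_iff_abs_le_one, abs_div, abs_two, div_le_one two_pos]
      simpa [hω] using hs
    obtain ⟨ζ, hadd, hmul⟩ := exists_add_conj_eq_and_mul_conj_eq hx
    have hζ : ‖ζ‖ = 1 := by
      rw [Complex.mul_conj'] at hmul
      exact (pow_eq_one_iff_of_nonneg (norm_nonneg ζ) two_ne_zero).1 (mod_cast hmul)
    refine ⟨ω * ζ, ω * conj ζ, by simp [hω, hζ], by simp [hω, hζ], Prod.ext ?_ ?_⟩
    · linear_combination (-ω) * hadd
    · linear_combination (-ω ^ 2) * hmul - ω ^ 2 * Complex.ofReal_one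

lemma isClosed_symTorus : IsClosed symTorus := by
  have h : symTorus = {x : ℂ × ℂ | ‖x.1‖ ≤ 2 ∧ ‖x.2‖ = 1 ∧ x.1 = conj x.1 * x.2} :=
    Set.ext fun _ => mem_symTorus_iff
  rw [h]
  exact (isClosed_le (by fun_prop) (by fun_prop)).and <|
    (isClosed_eq (by fun_prop) (by fun_prop)).and (isClosed_eq (by fun_prop) (by fun_prop))

lemma norm_sq_add_norm_sub_sq_le_of_mem_closure_symBidisc {x : ℂ × ℂ}
    (hx : x ∈ closure symBidisc) : ‖x.1 / 2‖ ^ 2 + ‖x.2 - (x.1 / 2) ^ 2‖ ≤ 1 := by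
  have hclosed : IsClosed {x : ℂ × ℂ | ‖x.1 / 2‖ ^ 2 + ‖x.2 - (x.1 / 2) ^ 2‖ ≤ 1} :=
    isClosed_le (by fun_prop) (by fun_prop)
  refine closure_minimal ?_ hclosed hx
  rintro _ ⟨z, w, hz, hw, rfl⟩
  have hsub : z * w - ((z + w) / 2) ^ 2 = -((z - w) / 2) ^ 2 := by ring
  have hpar := parallelogram_law_with_norm ℝ z w
  simp only [mem_ofPred_eq, hsub, norm_neg, norm_pow, norm_div, Complex.norm_ofNat]
  nlinarith [norm_nonneg z, norm_nonneg w]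

lemma norm_snd_le_one_of_mem_closure_symBidisc {x : ℂ × ℂ} (hx : x ∈ closure symBidisc) :
    ‖x.2‖ ≤ 1 := by
  have h := norm_add_le ((x.1 / 2) ^ 2) (x.2 - (x.1 / 2) ^ 2)
  rw [add_sub_cancel, norm_pow] at h
  exact h.trans (norm_sq_add_norm_sub_sq_le_of_mem_closure_symBidisc hx)

/- With `m = s / 2` and `q = p - m²`, the functional `2⟪m₀, m⟫ + ⟪p₀, q⟫` has real part at most
`‖m₀‖² + ‖m‖² - ‖m₀ - m‖² + ‖q‖ ≤ 1 + ‖m₀‖² - ‖m₀ - m‖²`, with equality at `(s₀, p₀)`. -/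
lemma isPeakPoint_symBidisc {u : ℂ × ℂ} (hu : u ∈ symTorus) : IsPeakPoint symBidisc u := by
  obtain ⟨-, hp, hs⟩ := mem_symTorus_iff.1 hu
  let h : ℂ × ℂ → ℂ := fun x =>
    2 * inner ℂ (u.1 / 2) (x.1 / 2) + inner ℂ u.2 (x.2 - (x.1 / 2) ^ 2)
  have hdiff : Differentiable ℂ h := by
    simp only [h, RCLike.inner_apply]
    fun_prop
  have hval : h u = 1 + ‖u.1 / 2‖ ^ 2 := by
    have hconj : conj u.1 = u.1 * conj u.2 := by simpa using congr_arg conj hs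
    have hunit : u.2 * conj u.2 = 1 := by simp [Complex.mul_conj', hp]
    simp only [h, RCLike.inner_apply, ← Complex.mul_conj', map_div₀, map_ofNat]
    linear_combination (u.1 / 4) * hconj + hunit
  refine isPeakPoint_of_forall_re_lt (mem_discAlgebra_of_differentiable hdiff)
    (isBoundaryFor_symTorus.1 hu) fun x hx hne => ?_
  have hbound := norm_sq_add_norm_sub_sq_le_of_mem_closure_symBidisc hx
  rcases eq_or_ne x.1 u.1 with heq | hne₁
  · have hne₂ : x.2 ≠ u.2 := fun h₂ => hne (Prod.ext heq h₂)
    have hlt := re_inner_lt_norm_sq (𝕜 := ℂ)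
      ((norm_snd_le_one_of_mem_closure_symBidisc hx).trans_eq hp.symm) hne₂
    rw [← inner_self_eq_norm_sq (𝕜 := ℂ)] at hlt
    simp only [h, heq, inner_sub_right, Complex.add_re, Complex.sub_re]
    gcongr
    exact hlt
  · have hpos : 0 < ‖u.1 / 2 - x.1 / 2‖ ^ 2 := by
      have := norm_sub_pos_iff.2 (show u.1 / 2 ≠ x.1 / 2 by grind)
      positivity
    have hinner : RCLike.re (inner ℂ u.2 (x.2 - (x.1 / 2) ^ 2)) ≤ ‖x.2 - (x.1 / 2) ^ 2‖ :=
      (re_inner_le_norm _ _).trans_eq (by rw [hp, one_mul])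
    calc (h x).re
        = 2 * RCLike.re (inner ℂ (u.1 / 2) (x.1 / 2))
          + RCLike.re (inner ℂ u.2 (x.2 - (x.1 / 2) ^ 2)) := by simp [h]
      _ < 1 + ‖u.1 / 2‖ ^ 2 := by
        rw [norm_sub_sq (𝕜 := ℂ)] at hpos
        linarith
      _ = (h u).re := by
        rw [hval]
        norm_cast

lemma distinguishedBoundary_symBidisc : distinguishedBoundary symBidisc = symTorus :=
  distinguishedBoundary_eq_of_forall_isPeakPoint ⟨isClosed_symTorus, isBoundaryFor_symTorus⟩
    fun _ => isPeakPoint_symBidisc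

end SymmetrisedBidisc

section Pentablock

lemma matrixBall_eq_ball : matrixBall = ball 0 1 := by
  ext A
  rw [mem_ball_zero_iff, ← l2_opNorm_toEuclideanCLM]
  rfl

lemma differentiable_pentaMap : Differentiable ℂ pentaMap := by
  unfold pentaMap
  simp only [trace_fin_two, det_fin_two]
  fun_prop

lemma isBoundaryFor_pentaMap_image_unitaryGroup :
    IsBoundaryFor pentablock (pentaMap '' unitaryGroup (Fin 2) ℂ) := by
  rw [pentablock, matrixBall_eq_ball]
  exact isBoundaryFor_unitaryGroup.image differentiable_pentaMap

lemma pentaMap_smul (c : ℂ) (A : Matrix (Fin 2) (Fin 2) ℂ) :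
    pentaMap (c • A) = (c * (pentaMap A).1, c * (pentaMap A).2.1, c ^ 2 * (pentaMap A).2.2) := by
  simp [pentaMap]

lemma norm_sq_add_norm_half_trace_sq_le_one {A : Matrix (Fin 2) (Fin 2) ℂ} (hA : ‖A‖ ≤ 1) :
    ‖A 1 0‖ ^ 2 + ‖A.trace / 2‖ ^ 2 ≤ 1 := by
  have hcol := sum_norm_sq_col_le A 0
  have hrow := sum_norm_sq_row_le A 1
  have hA' : ‖A‖ ^ 2 ≤ 1 := pow_le_one₀ (norm_nonneg A) hA
  have hpar := parallelogram_law_with_norm ℝ (A 0 0) (A 1 1)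
  rw [Fin.sum_univ_two] at hcol hrow
  rw [trace_fin_two, norm_div, Complex.norm_ofNat]
  linarith [mul_self_nonneg ‖A 0 0 - A 1 1‖]

lemma bounds_of_mem_closure_pentablock {x : ℂ × ℂ × ℂ} (hx : x ∈ closure pentablock) :
    ‖x.1‖ ^ 2 + ‖x.2.1 / 2‖ ^ 2 ≤ 1 ∧ ‖x.2.2‖ ≤ 1 := by
  have hclosed : IsClosed {x : ℂ × ℂ × ℂ | ‖x.1‖ ^ 2 + ‖x.2.1 / 2‖ ^ 2 ≤ 1 ∧ ‖x.2.2‖ ≤ 1} :=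
    (isClosed_le (by fun_prop) (by fun_prop)).and (isClosed_le (by fun_prop) (by fun_prop))
  refine closure_minimal ?_ hclosed hx
  rintro _ ⟨A, hA, rfl⟩
  rw [matrixBall_eq_ball, mem_ball_zero_iff] at hA
  exact ⟨norm_sq_add_norm_half_trace_sq_le_one hA.le, norm_det_le_one_of_l2_opNorm_le_one hA.le⟩

lemma trace_det_mem_symTorus {A : Matrix (Fin 2) (Fin 2) ℂ} (hA : A ∈ unitaryGroup (Fin 2) ℂ) :
    (A.trace, A.det) ∈ symTorus := by
  obtain ⟨hdet, hadj⟩ := mem_unitaryGroup_iff_adjugate.1 hA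
  refine mem_symTorus_iff.2 ⟨?_, hdet, ?_⟩
  · have h := norm_sq_add_norm_half_trace_sq_le_one (l2_opNorm_le_one_of_mem_unitaryGroup hA)
    have hhalf : ‖A.trace / 2‖ ≤ 1 := by
      rw [← sq_le_one_iff₀ (norm_nonneg _)]
      linarith [sq_nonneg ‖A 1 0‖]
    rw [norm_div, Complex.norm_ofNat] at hhalf
    linarith
  · calc A.trace = A.adjugate.trace := by simp [adjugate_fin_two, trace_fin_two, add_comm]
      _ = conj A.trace * A.det := by
        rw [hadj, trace_smul, trace_conjTranspose, smul_eq_mul, mul_comm, starRingEnd_apply]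

lemma exists_mem_unitaryGroup_pentaMap_eq {a s p : ℂ} (hsp : (s, p) ∈ symTorus)
    (ha : ‖a‖ ^ 2 + ‖s / 2‖ ^ 2 ≤ 1) : ∃ A ∈ unitaryGroup (Fin 2) ℂ, pentaMap A = (a, s, p) := by
  obtain ⟨-, hp, hs⟩ := mem_symTorus_iff.1 hsp
  obtain ⟨ω, x, hω, rfl, rfl⟩ := exists_eq_ofReal_mul_and_eq_sq hp hs
  have hconj : conj ω * ω = 1 := by simp [Complex.conj_mul', hω]
  have hx : (x / 2) ^ 2 ≤ 1 - ‖a‖ ^ 2 := by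
    simp only [norm_div, norm_mul, hω, Complex.norm_real, Real.norm_eq_abs, mul_one,
      Complex.norm_ofNat, div_pow, sq_abs] at ha
    linarith
  obtain ⟨ζ, hadd, hmul⟩ := exists_add_conj_eq_and_mul_conj_eq hx
  rw [Complex.ofReal_sub, Complex.ofReal_pow, ← Complex.conj_mul', Complex.ofReal_one] at hmul
  have hdet : (!![ω * ζ, -ω ^ 2 * conj a; a, ω * conj ζ] : Matrix _ _ ℂ).det = ω ^ 2 := by
    rw [det_fin_two_of]
    linear_combination ω ^ 2 * hmul
  refine ⟨!![ω * ζ, -ω ^ 2 * conj a; a, ω * conj ζ], ?_, Prod.ext rfl (Prod.ext ?_ hdet)⟩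
  · rw [mem_unitaryGroup_iff_adjugate, hdet, adjugate_fin_two_of]
    refine ⟨hp, ?_⟩
    simp only [← Matrix.ext_iff, Fin.forall_fin_two, of_apply, cons_val', cons_val_zero,
      cons_val_one, cons_val_fin_one, Matrix.smul_apply, conjTranspose_apply, smul_eq_mul,
      ← starRingEnd_apply, map_neg, map_mul, map_pow, Complex.conj_conj]
    refine ⟨⟨?_, ?_⟩, ?_, ?_⟩
    · linear_combination (-ω * conj ζ) * hconj
    · ring
    · linear_combination (conj ω * ω + 1) * a * hconj
    · linear_combination (-ω * ζ) * hconj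
  · rw [pentaMap, trace_fin_two_of]
    linear_combination ω * hadd

lemma mem_pentaMap_image_unitaryGroup_iff {a s p : ℂ} :
    (a, s, p) ∈ pentaMap '' unitaryGroup (Fin 2) ℂ ↔
      (s, p) ∈ symTorus ∧ ‖a‖ ^ 2 + ‖s / 2‖ ^ 2 ≤ 1 := by
  refine ⟨?_, fun h => exists_mem_unitaryGroup_pentaMap_eq h.1 h.2⟩
  rintro ⟨A, hA, h⟩
  obtain ⟨rfl, rfl, rfl⟩ : A 1 0 = a ∧ A.trace = s ∧ A.det = p := by simpa [pentaMap] using h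
  exact ⟨trace_det_mem_symTorus hA,
    norm_sq_add_norm_half_trace_sq_le_one (l2_opNorm_le_one_of_mem_unitaryGroup hA)⟩

lemma pentaK₀_eq : pentaK₀ = {x | ‖x.2.1‖ ≤ 2 ∧ ‖x.2.2‖ = 1 ∧ x.2.1 = conj x.2.1 * x.2.2 ∧
    ‖x.1‖ = √(1 - (1 / 4) * ‖x.2.1‖ ^ 2)} := by
  ext x
  simp only [pentaK₀, distinguishedBoundary_symBidisc, mem_ofPred_eq, mem_symTorus_iff, and_assoc]

lemma isClosed_pentaK₀ : IsClosed pentaK₀ := by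
  rw [pentaK₀_eq]
  exact (isClosed_le (by fun_prop) (by fun_prop)).and <|
    (isClosed_eq (by fun_prop) (by fun_prop)).and <|
    (isClosed_eq (by fun_prop) (by fun_prop)).and (isClosed_eq (by fun_prop) (by fun_prop))

lemma mem_pentaK₀_iff {a s p : ℂ} :
    (a, s, p) ∈ pentaK₀ ↔ (s, p) ∈ symTorus ∧ ‖a‖ ^ 2 + ‖s / 2‖ ^ 2 = 1 := by
  simp only [pentaK₀, distinguishedBoundary_symBidisc, mem_ofPred_eq]
  refine and_congr_right fun hsp => ?_
  have hs : ‖s‖ ≤ 2 := (mem_symTorus_iff.1 hsp).1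
  rw [eq_comm, Real.sqrt_eq_iff_eq_sq (by nlinarith [norm_nonneg s]) (norm_nonneg a), norm_div,
    Complex.norm_ofNat]
  constructor <;> intro h <;> linarith

lemma exists_norm_le_one_and_mul_ofReal_eq {a : ℂ} {R : ℝ} (ha : ‖a‖ ≤ R) :
    ∃ t : ℂ, ‖t‖ ≤ 1 ∧ t * R = a := by
  have hR : 0 ≤ R := (norm_nonneg a).trans ha
  refine ⟨a / R, ?_, div_mul_cancel_of_imp fun hR₀ => ?_⟩
  · simpa [abs_of_nonneg hR] using div_le_one_of_le₀ ha hR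
  · simpa [Complex.ofReal_eq_zero.1 hR₀] using ha

lemma pentaK₀_subset_closure_pentablock : pentaK₀ ⊆ closure pentablock := by
  rintro ⟨a, s, p⟩ hx
  obtain ⟨hsp, ha⟩ := mem_pentaK₀_iff.1 hx
  exact isBoundaryFor_pentaMap_image_unitaryGroup.1
    (mem_pentaMap_image_unitaryGroup_iff.2 ⟨hsp, ha.le⟩)

/- For `R² = 1 - ‖s / 2‖²` the points `(t * R, s, p)`, `‖t‖ ≤ 1`, form an analytic disc in
`π(U(2))` whose boundary circle lies in `K₀`. It is the limit as `r → 1` of the discs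
`(r * t * R, r * s, r² * p)` inside `π(r • U(2))`. -/
lemma isBoundaryFor_pentaK₀ : IsBoundaryFor pentablock pentaK₀ := by
  refine isBoundaryFor_pentaMap_image_unitaryGroup.of_forall_exists_norm_le
    pentaK₀_subset_closure_pentablock fun f hf ⟨a, s, p⟩ hx => ?_
  obtain ⟨hsp, ha⟩ := mem_pentaMap_image_unitaryGroup_iff.1 hx
  obtain ⟨R, hR₀, hR⟩ : ∃ R : ℝ, 0 ≤ R ∧ R ^ 2 = 1 - ‖s / 2‖ ^ 2 :=
    ⟨_, Real.sqrt_nonneg _, Real.sq_sqrt (by linarith [sq_nonneg ‖a‖])⟩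
  have haR : ‖a‖ ≤ R := le_of_sq_le_sq (by linarith) hR₀
  obtain ⟨t, ht, rfl⟩ := exists_norm_le_one_and_mul_ofReal_eq haR
  have hnorm (t : ℂ) : ‖t * R‖ ^ 2 = ‖t‖ ^ 2 * (1 - ‖s / 2‖ ^ 2) := by
    rw [norm_mul, mul_pow, Complex.norm_of_nonneg hR₀, hR]
  let H : ℝ → ℂ → ℂ × ℂ × ℂ := fun r t => (r * (t * R), r * s, r ^ 2 * p)
  have hcont : Continuous (uncurry H) := by
    unfold uncurry
    fun_prop
  have hdiff (r : ℝ) : Differentiable ℂ (H r) := by fun_prop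
  have hmem (r : ℝ) (hr : r ∈ Ico (0 : ℝ) 1) (t : ℂ) (ht : ‖t‖ ≤ 1) : H r t ∈ pentablock := by
    obtain ⟨B, hB, hBt⟩ := exists_mem_unitaryGroup_pentaMap_eq (a := t * R) hsp <| by
      have := mul_le_of_le_one_left (sq_nonneg R) (pow_le_one₀ (n := 2) (norm_nonneg t) ht)
      rw [hnorm, ← hR]
      linarith
    refine ⟨(r : ℂ) • B, ?_, by simp only [pentaMap_smul, hBt, H]⟩
    exact matrixBall_eq_ball ▸ ofReal_smul_mem_ball (l2_opNorm_le_one_of_mem_unitaryGroup hB) hr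
  obtain ⟨t', ht', hle⟩ := exists_norm_eq_one_and_norm_le hf hcont hdiff hmem ht
  refine ⟨(t' * R, s, p), mem_pentaK₀_iff.2 ⟨hsp, ?_⟩, by simpa [H] using hle⟩
  rw [hnorm, ht']
  ring

lemma isPeakPoint_pentablock {u : ℂ × ℂ × ℂ} (hu : u ∈ pentaK₀) : IsPeakPoint pentablock u := by
  let φ : ℂ × ℂ × ℂ → EuclideanSpace ℂ (Fin 3) := fun x => !₂[x.1, x.2.1 / 2, x.2.2]
  have hnorm (x : ℂ × ℂ × ℂ) : ‖φ x‖ ^ 2 = ‖x.1‖ ^ 2 + ‖x.2.1 / 2‖ ^ 2 + ‖x.2.2‖ ^ 2 := by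
    rw [EuclideanSpace.norm_sq_eq, Fin.sum_univ_three]
    rfl
  have hdiff : Differentiable ℂ φ := by
    refine differentiable_euclidean.2 (Fin.forall_fin_succ.2 ⟨?_, Fin.forall_fin_two.2 ⟨?_, ?_⟩⟩)
    · exact differentiable_fst
    · change Differentiable ℂ fun x : ℂ × ℂ × ℂ => x.2.1 / 2
      fun_prop
    · change Differentiable ℂ fun x : ℂ × ℂ × ℂ => x.2.2
      fun_prop
  have hinj : Injective φ := fun x y h => by
    have h' (i : Fin 3) : φ x i = φ y i := congr_arg (· i) h
    exact Prod.ext (h' 0) (Prod.ext ((div_left_inj' two_ne_zero).1 (h' 1)) (h' 2))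
  refine isPeakPoint_of_forall_norm_le hdiff hinj (pentaK₀_subset_closure_pentablock hu)
    fun x hx => ?_
  obtain ⟨hx₁, hx₂⟩ := bounds_of_mem_closure_pentablock hx
  obtain ⟨hsp, hu₁⟩ := mem_pentaK₀_iff.1 hu
  obtain ⟨-, hu₂, -⟩ := mem_symTorus_iff.1 hsp
  have hx₂' : ‖x.2.2‖ ^ 2 ≤ 1 := pow_le_one₀ (norm_nonneg _) hx₂
  rw [← sq_le_sq₀ (norm_nonneg _) (norm_nonneg _), hnorm, hnorm, hu₁, hu₂]
  linarith

lemma distinguishedBoundary_pentablock : distinguishedBoundary pentablock = pentaK₀ :=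
  distinguishedBoundary_eq_of_forall_isPeakPoint ⟨isClosed_pentaK₀, isBoundaryFor_pentaK₀⟩
    fun _ => isPeakPoint_pentablock

end Pentablock

theorem mainTheorem3 :
    -- `𝔾` has a smallest closed boundary `bΓ`, which is the symmetrised torus
    (IsLeast (closedBoundaries symBidisc) (distinguishedBoundary symBidisc) ∧
      distinguishedBoundary symBidisc = symTorus) ∧
    -- `𝒫` has a smallest closed boundary `b𝒫`
    IsLeast (closedBoundaries pentablock) (distinguishedBoundary pentablock) ∧
    (∀ x : ℂ × ℂ × ℂ, List.TFAE
      [x ∈ pentaK₀,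
       IsPeakPoint pentablock x,
       x ∈ distinguishedBoundary pentablock]) ∧
    distinguishedBoundary pentablock =
      {x : ℂ × ℂ × ℂ | (x.2.1, x.2.2) ∈ distinguishedBoundary symBidisc ∧
        ‖x.1‖ = Real.sqrt (1 - (1 / 4) * ‖x.2.1‖ ^ 2)} ∧
    distinguishedBoundary pentablock =
      {x : ℂ × ℂ × ℂ | ‖x.2.1‖ ≤ 2 ∧ ‖x.2.2‖ = 1 ∧
        x.2.1 = (starRingEnd ℂ) x.2.1 * x.2.2 ∧
        ‖x.1‖ = Real.sqrt (1 - (1 / 4) * ‖x.2.1‖ ^ 2)} := by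
  refine ⟨⟨isLeast_distinguishedBoundary ?_, distinguishedBoundary_symBidisc⟩,
    isLeast_distinguishedBoundary ?_, fun x => ?_, distinguishedBoundary_pentablock,
    distinguishedBoundary_pentablock.trans pentaK₀_eq⟩
  · rw [distinguishedBoundary_symBidisc]
    exact ⟨isClosed_symTorus, isBoundaryFor_symTorus⟩
  · rw [distinguishedBoundary_pentablock]
    exact ⟨isClosed_pentaK₀, isBoundaryFor_pentaK₀⟩
  · tfae_have 1 → 2 := isPeakPoint_pentablock
    tfae_have 2 → 3 := IsPeakPoint.mem_distinguishedBoundary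
    tfae_have 3 → 1 := fun h => distinguishedBoundary_pentablock ▸ h
    tfae_finish
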